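/- Let $\Omega=(0,1)^2$ and, for integers $m,n\ge 1$, let $\phi_{m,n}(x,y)=2\sin(m\pi x)\sin(n\pi y)$; these are the $L^2(\Omega)$-orthonormal Dirichlet eigenfunctions of $-\Delta$ on $\Omega$, with eigenvalues $\lambda_{m,n}=\pi^2(m^2+n^2)$. For a real-valued $u\in L^2(\Omega)$ put $\hat u_{m,n}=\int_\Omega u\,\phi_{m,n}\,dx$ and, for an integer $M\ge 1$, $$\Pi_M u=\sum_{1\le m\le M}\ \sum_{1\le n\le M}\hat u_{m,n}\,\phi_{m,n}.$$ Write $\|v\|_{H_0^1(\Omega)}=\bigl(\int_\Omega|\nabla v|^2\,dx\bigr)^{1/2}$ and $\|u\|_{H^2(\Omega)}=\bigl(\sum_{|\alpha|\le 2}\|D^\alpha u\|_{L^2(\Omega)}^2\bigr)^{1/2}$, with weak derivatives, and let $H_0^1(\Omega)$ be the closure of $C_c^\infty(\Omega)$ in $H^1(\Omega)$. Then there is a constant $C>0$ such that for every $u\in H^2(\Omega)\cap H_0^1(\Omega)$ one has $u=\sum_{m,n\ge1}\hat u_{m,n}\phi_{m,n}$ in $L^2(\Omega)$, and for every integer $M\ge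 2$ the function $u-\Pi_M u$ belongs to $H_0^1(\Omega)$ and $$\|u-\Pi_M u\|_{H_0^1(\Omega)}\le C\,\frac{\sqrt{\log M}}{M}\,\|u\|_{H^2(\Omega)}.$$ In particular $C$ depends neither on $M$ nor on $u$. -/

import Mathlib

open MeasureTheory Set
open scoped Distributions ContDiff

namespace SquareSobolev

/-- The open unit square `Ω = (0,1)²`. -/
def unitSquare : TopologicalSpace.Opens (ℝ × ℝ) :=
  ⟨Ioo 0 1 ×ˢ Ioo 0 1, isOpen_Ioo.prod isOpen_Ioo⟩

/-- Lebesgue measure on `Ω`. -/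
noncomputable abbrev squareMeasure : Measure (ℝ × ℝ) :=
  volume.restrict (unitSquare : Set (ℝ × ℝ))

/-- The Hilbert space `L²(Ω)` of real-valued functions. -/
abbrev L2 : Type := Lp ℝ 2 squareMeasure

instance isFiniteMeasure_squareMeasure : IsFiniteMeasure squareMeasure := by
  refine ⟨?_⟩
  rw [Measure.restrict_apply_univ]
  refine lt_of_le_of_lt (measure_mono (t := Icc (0 : ℝ) 1 ×ˢ Icc (0 : ℝ) 1) ?_)
    (isCompact_Icc.prod isCompact_Icc).measure_lt_top
  exact prod_mono Ioo_subset_Icc_self Ioo_subset_Icc_self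

/-- `g ∈ L²(Ω)` is the weak partial derivative of `f ∈ L²(Ω)` in the direction `v`:
`∫_Ω f ∂_v ψ = - ∫_Ω g ψ` for all `ψ ∈ C_c^∞(Ω)`. -/
def IsWeakDeriv (v : ℝ × ℝ) (f g : L2) : Prop :=
  ∀ ψ : 𝓓(unitSquare, ℝ),
    ∫ x in (unitSquare : Set (ℝ × ℝ)), f x * fderiv ℝ ψ x v
      = -∫ x in (unitSquare : Set (ℝ × ℝ)), g x * ψ x

open Classical in
/-- The weak derivative in the direction `v` (the value `0` is assigned if there is none in
`L²(Ω)`). -/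
noncomputable def weakDeriv (v : ℝ × ℝ) (f : L2) : L2 :=
  if h : ∃ g : L2, IsWeakDeriv v f g then h.choose else 0

/-- The weak partial derivative in the first variable. -/
noncomputable abbrev dX (f : L2) : L2 := weakDeriv (1, 0) f

/-- The weak partial derivative in the second variable. -/
noncomputable abbrev dY (f : L2) : L2 := weakDeriv (0, 1) f

/-- Weak derivatives are unique. -/
theorem IsWeakDeriv.unique {v : ℝ × ℝ} {f g h : L2}
    (hg : IsWeakDeriv v f g) (hh : IsWeakDeriv v f h) : g = h := by
  have hint : ∀ k : L2, Integrable k squareMeasure := fun k =>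
    (Lp.memLp k).integrable (by norm_num)
  have hloc : LocallyIntegrableOn (fun x => g x - h x) (unitSquare : Set (ℝ × ℝ)) volume :=
    IntegrableOn.locallyIntegrableOn ((hint g).sub (hint h))
  have key := unitSquare.isOpen.ae_eq_zero_of_integral_contDiff_smul_eq_zero hloc (by
    intro ψ h1 h2 h3
    have e := (hg ⟨ψ, h1, h2, h3⟩).symm.trans (hh ⟨ψ, h1, h2, h3⟩)
    simp only [neg_inj] at e
    obtain ⟨c, hc⟩ := h1.continuous.bounded_above_of_compact_support h2
    have hm : ∀ k : L2, Integrable (fun x => k x * ψ x) squareMeasure := fun k =>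
      (hint k).mul_bdd (c := c) h1.continuous.aestronglyMeasurable (Filter.Eventually.of_forall hc)
    rw [← setIntegral_eq_integral_of_forall_compl_eq_zero
      (s := (unitSquare : Set (ℝ × ℝ)))]
    · calc ∫ x in (unitSquare : Set (ℝ × ℝ)), ψ x • (g x - h x)
          = ∫ x in (unitSquare : Set (ℝ × ℝ)), (g x * ψ x - h x * ψ x) := by
            congr 1; ext x; simp only [smul_eq_mul]; ring
        _ = 0 := by rw [integral_sub (hm g) (hm h)]; exact sub_eq_zero.2 e
    · intro x hx
      rw [image_eq_zero_of_notMem_tsupport (fun hx' => hx (h3 hx')), zero_smul])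
  refine Lp.ext ?_
  rw [Filter.EventuallyEq, ae_restrict_iff' unitSquare.isOpen.measurableSet]
  filter_upwards [key] with x hx hxm
  exact sub_eq_zero.1 (hx hxm)

theorem IsWeakDeriv.weakDeriv_eq {v : ℝ × ℝ} {f g : L2} (hg : IsWeakDeriv v f g) :
    weakDeriv v f = g := by
  have h : ∃ g : L2, IsWeakDeriv v f g := ⟨g, hg⟩
  rw [weakDeriv, dif_pos h]
  exact h.choose_spec.unique hg

/-- `f ∈ H¹(Ω)`: both first order weak derivatives exist in `L²(Ω)`. -/
def MemH1 (f : L2) : Prop :=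
  (∃ g : L2, IsWeakDeriv (1, 0) f g) ∧ ∃ g : L2, IsWeakDeriv (0, 1) f g

/-- `f ∈ H²(Ω)`: all weak derivatives of order at most two exist in `L²(Ω)`. -/
def MemH2 (f : L2) : Prop :=
  MemH1 f ∧ MemH1 (dX f) ∧ MemH1 (dY f)

/-- The full `H¹(Ω)` norm. -/
noncomputable def normH1 (f : L2) : ℝ :=
  √(‖f‖ ^ 2 + ‖dX f‖ ^ 2 + ‖dY f‖ ^ 2)

/-- The `H²(Ω)` norm `(∑_{|α| ≤ 2} ‖D^α f‖²_{L²})^{1/2}`. -/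
noncomputable def normH2 (f : L2) : ℝ :=
  √(‖f‖ ^ 2 + ‖dX f‖ ^ 2 + ‖dY f‖ ^ 2
    + ‖dX (dX f)‖ ^ 2 + ‖dX (dY f)‖ ^ 2 + ‖dY (dY f)‖ ^ 2)

/-- The energy norm `‖f‖_{H₀¹} = (∫_Ω |∇f|²)^{1/2}`. -/
noncomputable def normH01 (f : L2) : ℝ :=
  √(‖dX f‖ ^ 2 + ‖dY f‖ ^ 2)

/-- A test function, as an element of `L²(Ω)`. -/
noncomputable def testToL2 (ψ : 𝓓(unitSquare, ℝ)) : L2 :=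
  MemLp.toLp ψ (ψ.continuous.memLp_of_hasCompactSupport ψ.hasCompactSupport)

/-- `f ∈ H₀¹(Ω)`: `f` lies in the closure of `C_c^∞(Ω)` in `H¹(Ω)`. -/
def MemH01 (f : L2) : Prop :=
  MemH1 f ∧ ∀ ε > 0, ∃ ψ : 𝓓(unitSquare, ℝ), normH1 (f - testToL2 ψ) < ε

/-- The function `φ_{m,n}(x,y) = 2 sin(mπx) sin(nπy)`. -/
noncomputable def sineFun (m n : ℕ) (x : ℝ × ℝ) : ℝ :=
  2 * Real.sin (m * Real.pi * x.1) * Real.sin (n * Real.pi * x.2)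

/-- `λ_{m,n} = π²(m² + n²)`. -/
noncomputable def dirichletEigenvalue (m n : ℕ) : ℝ :=
  Real.pi ^ 2 * ((m : ℝ) ^ 2 + (n : ℝ) ^ 2)

theorem memLp_sineFun (m n : ℕ) : MemLp (sineFun m n) 2 squareMeasure := by
  refine MemLp.of_bound (C := 2) ?_ (Filter.Eventually.of_forall fun x => ?_)
  · exact Continuous.aestronglyMeasurable (by unfold sineFun; fun_prop)
  · unfold sineFun
    rw [norm_mul, norm_mul, Real.norm_eq_abs, Real.norm_eq_abs, Real.norm_eq_abs]
    have h1 := Real.abs_sin_le_one (m * Real.pi * x.1)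
    have h2 := Real.abs_sin_le_one (n * Real.pi * x.2)
    have h3 := abs_nonneg (Real.sin (n * Real.pi * x.2))
    have h4 := abs_nonneg (Real.sin (m * Real.pi * x.1))
    rw [abs_of_pos (by norm_num : (0 : ℝ) < 2)]
    nlinarith

/-- The eigenfunction `φ_{m,n}` as an element of `L²(Ω)`. -/
noncomputable def sineMode (m n : ℕ) : L2 := (memLp_sineFun m n).toLp

/-- The coefficient `û_{m,n} = (u, φ_{m,n})_{L²(Ω)}`. -/
noncomputable def sineCoeff (u : L2) (m n : ℕ) : ℝ := inner ℝ (sineMode m n) u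

/-- The rectangular spectral projector `Π_M u = ∑_{1 ≤ m,n ≤ M} û_{m,n} φ_{m,n}`. -/
noncomputable def spectralProj (M : ℕ) (u : L2) : L2 :=
  ∑ m ∈ Finset.Icc 1 M, ∑ n ∈ Finset.Icc 1 M, sineCoeff u m n • sineMode m n

/-- `φ_{m,n}` vanishes on the boundary of the square. -/
theorem sineFun_boundary (m n : ℕ) (x : ℝ × ℝ)
    (hx : x.1 = 0 ∨ x.1 = 1 ∨ x.2 = 0 ∨ x.2 = 1) : sineFun m n x = 0 := by
  unfold sineFun
  rcases hx with h | h | h | h <;> simp [h, Real.sin_nat_mul_pi]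

/-- `-Δ φ_{m,n} = λ_{m,n} φ_{m,n}`. -/
theorem neg_laplacian_sineFun (m n : ℕ) (x y : ℝ) :
    -(deriv (deriv fun s => sineFun m n (s, y)) x + deriv (deriv fun t => sineFun m n (x, t)) y)
      = dirichletEigenvalue m n * sineFun m n (x, y) := by
  have hs : ∀ a s : ℝ, HasDerivAt (fun s => Real.sin (a * s)) (Real.cos (a * s) * a) s :=
    fun a s => by simpa using ((hasDerivAt_id s).const_mul a).sin
  have hc : ∀ a s : ℝ, HasDerivAt (fun s => Real.cos (a * s)) (-Real.sin (a * s) * a) s :=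
    fun a s => by simpa using ((hasDerivAt_id s).const_mul a).cos
  have e1 : (deriv fun s => sineFun m n (s, y)) = fun s =>
      2 * (Real.cos (m * Real.pi * s) * (m * Real.pi)) * Real.sin (n * Real.pi * y) := by
    ext s
    exact (((hs (m * Real.pi) s).const_mul 2).mul_const (Real.sin (n * Real.pi * y))).deriv
  have e2 : (deriv fun t => sineFun m n (x, t)) = fun t =>
      2 * Real.sin (m * Real.pi * x) * (Real.cos (n * Real.pi * t) * (n * Real.pi)) := by
    ext t
    exact ((hs (n * Real.pi) t).const_mul (2 * Real.sin (m * Real.pi * x))).deriv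
  rw [e1, e2, (((((hc (m * Real.pi) x).mul_const (m * Real.pi)).const_mul 2).mul_const
    (Real.sin (n * Real.pi * y)))).deriv, (((hc (n * Real.pi) y).mul_const
    (n * Real.pi)).const_mul (2 * Real.sin (m * Real.pi * x))).deriv]
  unfold dirichletEigenvalue sineFun
  ring

theorem integral_sin_mul_sin (m m' : ℕ+) :
    ∫ x in Ioo (0 : ℝ) 1, Real.sin (m * Real.pi * x) * Real.sin (m' * Real.pi * x)
      = if m = m' then 1 / 2 else 0 := by
  have hcos : ∀ k : ℤ, k ≠ 0 → ∫ x in (0 : ℝ)..1, Real.cos (k * Real.pi * x) = 0 := by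
    intro k hk
    have hk' : (k : ℝ) * Real.pi ≠ 0 := mul_ne_zero (by exact_mod_cast hk) Real.pi_ne_zero
    rw [intervalIntegral.integral_comp_mul_left (fun x => Real.cos x) hk']
    simp [Real.sin_int_mul_pi]
  rw [← integral_Ioc_eq_integral_Ioo, ← intervalIntegral.integral_of_le zero_le_one]
  have hprod : ∀ x : ℝ, Real.sin (m * Real.pi * x) * Real.sin (m' * Real.pi * x)
      = (1 / 2) * (Real.cos ((((m : ℕ) : ℤ) - ((m' : ℕ) : ℤ) : ℤ) * Real.pi * x)
        - Real.cos ((((m : ℕ) : ℤ) + ((m' : ℕ) : ℤ) : ℤ) * Real.pi * x)) := by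
    intro x
    have e1 : ((((m : ℕ) : ℤ) - ((m' : ℕ) : ℤ) : ℤ) : ℝ) * Real.pi * x
        = m * Real.pi * x - m' * Real.pi * x := by push_cast; ring
    have e2 : ((((m : ℕ) : ℤ) + ((m' : ℕ) : ℤ) : ℤ) : ℝ) * Real.pi * x
        = m * Real.pi * x + m' * Real.pi * x := by push_cast; ring
    rw [e1, e2, Real.cos_sub, Real.cos_add]
    ring
  have hm := m.pos
  have hm' := m'.pos
  simp_rw [hprod]
  rw [intervalIntegral.integral_const_mul, intervalIntegral.integral_sub
    (Continuous.intervalIntegrable (by fun_prop) _ _)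
    (Continuous.intervalIntegrable (by fun_prop) _ _),
    hcos (((m : ℕ) : ℤ) + ((m' : ℕ) : ℤ)) (by omega)]
  split_ifs with h
  · subst h
    simp
  · rw [hcos _ (by
      intro h0
      exact h (PNat.eq (by omega)))]
    simp

/-- The functions `φ_{m,n}`, `m, n ≥ 1`, are orthonormal in `L²(Ω)`. -/
theorem orthonormal_sineMode :
    Orthonormal ℝ (fun p : ℕ+ × ℕ+ => sineMode (p.1 : ℕ) (p.2 : ℕ)) := by
  rw [orthonormal_iff_ite]
  rintro ⟨m, n⟩ ⟨m', n'⟩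
  rw [L2.inner_def]
  have h1 : ∫ x, inner ℝ (sineMode m n x) (sineMode m' n' x) ∂squareMeasure
      = ∫ x in (Ioo (0 : ℝ) 1 ×ˢ Ioo (0 : ℝ) 1),
        (2 * (Real.sin (m * Real.pi * x.1) * Real.sin (m' * Real.pi * x.1)))
        * (2 * (Real.sin (n * Real.pi * x.2) * Real.sin (n' * Real.pi * x.2))) := by
    refine integral_congr_ae ?_
    filter_upwards [(memLp_sineFun m n).coeFn_toLp, (memLp_sineFun m' n').coeFn_toLp]
      with x hx hx'
    rw [sineMode, sineMode, hx, hx']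
    simp only [sineFun, RCLike.inner_apply, conj_trivial]
    ring
  rw [h1, Measure.volume_eq_prod, setIntegral_prod_mul
    (fun s : ℝ => 2 * (Real.sin (m * Real.pi * s) * Real.sin (m' * Real.pi * s)))
    (fun t : ℝ => 2 * (Real.sin (n * Real.pi * t) * Real.sin (n' * Real.pi * t))),
    integral_const_mul, integral_const_mul, integral_sin_mul_sin, integral_sin_mul_sin]
  by_cases a : m = m' <;> by_cases b : n = n' <;> simp [a, b]

end SquareSobolev

namespace SquareSobolev

open Filter Topology

/-! The estimate comes from Green's identity and a spectral gap. Put `v = u - Π_M u`, which lies in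
`H₀¹` and has a Laplacian `V` in `L²`. Then `∫|∇v|² = -∫ v V ≤ ‖v‖ ‖V‖`. On `H₀¹` the Laplacian is
symmetric, so it multiplies each sine coefficient by `-λ_{m,n}` (`HasLaplacian.sineCoeff_eq`). The
coefficients of `V` are therefore those of `Δu` outside the box of frequencies at most `M` and zero
inside it, whence `‖V‖ ≤ ‖Δu‖`. Outside the box `λ_{m,n} ≥ π² M²`, so `π² M² ‖v‖ ≤ ‖V‖`. Together,
`π² M² ∫|∇v|² ≤ ‖Δu‖² ≤ 2 ‖u‖²_{H²}`. This is decay of order `1/M`; the logarithm is slack, used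
only through its lower bound at `M = 2`.

Two facts about the modes support this. They are complete (`sineBasis`): the cosines of `πx` and
`πy` multiply the span of the sine products into itself and separate points of the closed square, so
Stone–Weierstrass applies. They lie in `H₀¹` (`memH01_sineMode`): cutting off at distance about
`1/k` from the boundary costs a derivative of order `k`, which the linear vanishing of the sine
compensates. -/

/-! ### Continuous functions in `L²(Ω)` and calculus of weak derivatives -/

theorem memLp_of_continuous {g : ℝ × ℝ → ℝ} (hg : Continuous g) : MemLp g 2 squareMeasure := by
  have hK : IsCompact (Icc (0 : ℝ) 1 ×ˢ Icc (0 : ℝ) 1) := isCompact_Icc.prod isCompact_Icc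
  obtain ⟨C, hC⟩ := hK.exists_bound_of_continuousOn hg.continuousOn
  refine MemLp.of_bound (C := C) hg.aestronglyMeasurable ?_
  filter_upwards [ae_restrict_mem unitSquare.isOpen.measurableSet] with x hx
  exact hC x (prod_mono Ioo_subset_Icc_self Ioo_subset_Icc_self hx)

/-- The class in `L²(Ω)` of a continuous function on the plane. -/
noncomputable def contToL2 (g : ℝ × ℝ → ℝ) (hg : Continuous g) : L2 :=
  (memLp_of_continuous hg).toLp

theorem coeFn_contToL2 {g : ℝ × ℝ → ℝ} (hg : Continuous g) :
    contToL2 g hg =ᵐ[squareMeasure] g :=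
  (memLp_of_continuous hg).coeFn_toLp

theorem contToL2_smul (c : ℝ) {g : ℝ × ℝ → ℝ} (hg : Continuous g) :
    contToL2 (fun x => c * g x) (continuous_const.mul hg) = c • contToL2 g hg := rfl

theorem contToL2_add {f g : ℝ × ℝ → ℝ} (hf : Continuous f) (hg : Continuous g) :
    contToL2 (fun x => f x + g x) (hf.add hg) = contToL2 f hf + contToL2 g hg := rfl

theorem inner_contToL2 {g : ℝ × ℝ → ℝ} (hg : Continuous g) (f : L2) :
    inner ℝ (contToL2 g hg) f = ∫ x in (unitSquare : Set (ℝ × ℝ)), f x * g x := by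
  rw [L2.inner_def]
  refine integral_congr_ae ?_
  filter_upwards [coeFn_contToL2 hg] with x hx
  rw [hx]
  simp

theorem continuous_fderiv_apply {g : ℝ × ℝ → ℝ} (hg : ContDiff ℝ ∞ g) (v : ℝ × ℝ) :
    Continuous fun x => fderiv ℝ g x v :=
  (hg.continuous_fderiv (by simp)).clm_apply continuous_const

/-- The directional derivative of a test function, as an element of `L²(Ω)`. -/
noncomputable def testDeriv (v : ℝ × ℝ) (ψ : 𝓓(unitSquare, ℝ)) : L2 :=
  contToL2 (fun x => fderiv ℝ ψ x v) (continuous_fderiv_apply ψ.contDiff v)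

theorem testToL2_eq (ψ : 𝓓(unitSquare, ℝ)) : testToL2 ψ = contToL2 ψ ψ.continuous := rfl

/-- In this form linearity and limits of weak derivatives become Hilbert space algebra. -/
theorem isWeakDeriv_iff {v : ℝ × ℝ} {f g : L2} :
    IsWeakDeriv v f g ↔
      ∀ ψ : 𝓓(unitSquare, ℝ), inner ℝ (testDeriv v ψ) f = -inner ℝ (testToL2 ψ) g := by
  simp_rw [testToL2_eq, testDeriv, inner_contToL2]
  rfl

theorem IsWeakDeriv.add {v : ℝ × ℝ} {f g f' g' : L2} (hf : IsWeakDeriv v f f')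
    (hg : IsWeakDeriv v g g') : IsWeakDeriv v (f + g) (f' + g') := by
  rw [isWeakDeriv_iff] at *
  intro ψ
  rw [inner_add_right, inner_add_right, hf, hg]
  ring

theorem IsWeakDeriv.const_smul {v : ℝ × ℝ} {f f' : L2} (c : ℝ) (hf : IsWeakDeriv v f f') :
    IsWeakDeriv v (c • f) (c • f') := by
  rw [isWeakDeriv_iff] at *
  intro ψ
  rw [inner_smul_right, inner_smul_right, hf]
  ring

theorem IsWeakDeriv.sub {v : ℝ × ℝ} {f g f' g' : L2} (hf : IsWeakDeriv v f f')
    (hg : IsWeakDeriv v g g') : IsWeakDeriv v (f - g) (f' - g') := by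
  simpa [sub_eq_add_neg] using hf.add (hg.const_smul (-1))

theorem isWeakDeriv_weakDeriv {v : ℝ × ℝ} {f : L2} (h : ∃ g, IsWeakDeriv v f g) :
    IsWeakDeriv v f (weakDeriv v f) := by
  obtain ⟨g, hg⟩ := h
  rwa [hg.weakDeriv_eq]

/-- The classical derivative of a smooth function is its weak derivative. -/
theorem isWeakDeriv_contToL2 {g : ℝ × ℝ → ℝ} (hg : ContDiff ℝ ∞ g) (v : ℝ × ℝ) :
    IsWeakDeriv v (contToL2 g hg.continuous)
      (contToL2 (fun x => fderiv ℝ g x v) (continuous_fderiv_apply hg v)) := by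
  intro ψ
  have hdψ := continuous_fderiv_apply ψ.contDiff v
  have hdg := continuous_fderiv_apply hg v
  have hsupp : HasCompactSupport fun x => fderiv ℝ ψ x v := ψ.hasCompactSupport.fderiv_apply ℝ v
  have e1 : ∫ x in (unitSquare : Set (ℝ × ℝ)), contToL2 g hg.continuous x * fderiv ℝ ψ x v
      = ∫ x, g x * fderiv ℝ ψ x v := by
    rw [← setIntegral_eq_integral_of_forall_compl_eq_zero
      (s := (unitSquare : Set (ℝ × ℝ))) (f := fun x => g x * fderiv ℝ ψ x v)]
    · refine integral_congr_ae ?_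
      filter_upwards [coeFn_contToL2 hg.continuous] with x hx
      rw [hx]
    · intro x hx
      have : x ∉ tsupport (fderiv ℝ ψ) := fun h =>
        hx (ψ.tsupport_subset (tsupport_fderiv_subset ℝ h))
      rw [image_eq_zero_of_notMem_tsupport this]
      simp
  have e2 : ∫ x in (unitSquare : Set (ℝ × ℝ)),
        contToL2 (fun x => fderiv ℝ g x v) hdg x * ψ x
      = ∫ x, fderiv ℝ g x v * ψ x := by
    rw [← setIntegral_eq_integral_of_forall_compl_eq_zero
      (s := (unitSquare : Set (ℝ × ℝ))) (f := fun x => fderiv ℝ g x v * ψ x)]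
    · refine integral_congr_ae ?_
      filter_upwards [coeFn_contToL2 hdg] with x hx
      rw [hx]
    · intro x hx
      rw [image_eq_zero_of_notMem_tsupport fun h => hx (ψ.tsupport_subset h), mul_zero]
  rw [e1, e2]
  refine integral_mul_fderiv_eq_neg_fderiv_mul_of_integrable ?_ ?_ ?_
    (fun x _ => hg.differentiable (by simp) x)
    (fun x _ => ψ.contDiff.differentiable (by simp) x)
  · exact (hdg.mul ψ.continuous).integrable_of_hasCompactSupport ψ.hasCompactSupport.mul_left
  · exact (hg.continuous.mul hdψ).integrable_of_hasCompactSupport hsupp.mul_left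
  · exact (hg.continuous.mul ψ.continuous).integrable_of_hasCompactSupport
      ψ.hasCompactSupport.mul_left

theorem isWeakDeriv_testToL2 (v : ℝ × ℝ) (ψ : 𝓓(unitSquare, ℝ)) :
    IsWeakDeriv v (testToL2 ψ) (testDeriv v ψ) :=
  isWeakDeriv_contToL2 ψ.contDiff v

/-! ### The space `H₀¹(Ω)` and integration by parts -/

theorem MemH1.isWeakDeriv_dX {f : L2} (h : MemH1 f) : IsWeakDeriv (1, 0) f (dX f) :=
  isWeakDeriv_weakDeriv h.1

theorem MemH1.isWeakDeriv_dY {f : L2} (h : MemH1 f) : IsWeakDeriv (0, 1) f (dY f) :=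
  isWeakDeriv_weakDeriv h.2

theorem norm_le_normH1 (f : L2) : ‖f‖ ≤ normH1 f := by
  refine Real.le_sqrt_of_sq_le ?_
  nlinarith [sq_nonneg ‖dX f‖, sq_nonneg ‖dY f‖]

theorem norm_dX_le_normH1 (f : L2) : ‖dX f‖ ≤ normH1 f := by
  refine Real.le_sqrt_of_sq_le ?_
  nlinarith [sq_nonneg ‖f‖, sq_nonneg ‖dY f‖]

theorem norm_dY_le_normH1 (f : L2) : ‖dY f‖ ≤ normH1 f := by
  refine Real.le_sqrt_of_sq_le ?_
  nlinarith [sq_nonneg ‖f‖, sq_nonneg ‖dX f‖]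

theorem normH1_le (f : L2) : normH1 f ≤ ‖f‖ + ‖dX f‖ + ‖dY f‖ := by
  refine Real.sqrt_le_iff.2 ⟨by positivity, ?_⟩
  nlinarith [mul_nonneg (norm_nonneg f) (norm_nonneg (dX f)),
    mul_nonneg (norm_nonneg f) (norm_nonneg (dY f)),
    mul_nonneg (norm_nonneg (dX f)) (norm_nonneg (dY f))]

/-- Test functions approximating `f` together with its weak derivatives. -/
theorem memH01_iff {f : L2} :
    MemH01 f ↔ ∃ fx fy : L2, IsWeakDeriv (1, 0) f fx ∧ IsWeakDeriv (0, 1) f fy ∧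
      ∀ ε > 0, ∃ ψ : 𝓓(unitSquare, ℝ), ‖f - testToL2 ψ‖ < ε ∧
        ‖fx - testDeriv (1, 0) ψ‖ < ε ∧ ‖fy - testDeriv (0, 1) ψ‖ < ε := by
  constructor
  · rintro ⟨h1, h2⟩
    refine ⟨dX f, dY f, h1.isWeakDeriv_dX, h1.isWeakDeriv_dY, fun ε hε => ?_⟩
    obtain ⟨ψ, hψ⟩ := h2 ε hε
    refine ⟨ψ, (norm_le_normH1 _).trans_lt hψ, ?_, ?_⟩
    · rw [← (h1.isWeakDeriv_dX.sub (isWeakDeriv_testToL2 _ ψ)).weakDeriv_eq]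
      exact (norm_dX_le_normH1 _).trans_lt hψ
    · rw [← (h1.isWeakDeriv_dY.sub (isWeakDeriv_testToL2 _ ψ)).weakDeriv_eq]
      exact (norm_dY_le_normH1 _).trans_lt hψ
  · rintro ⟨fx, fy, hx, hy, h⟩
    refine ⟨⟨⟨fx, hx⟩, fy, hy⟩, fun ε hε => ?_⟩
    obtain ⟨ψ, h1, h2, h3⟩ := h (ε / 3) (by positivity)
    refine ⟨ψ, (normH1_le _).trans_lt ?_⟩
    rw [dX, dY, (hx.sub (isWeakDeriv_testToL2 _ ψ)).weakDeriv_eq,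
      (hy.sub (isWeakDeriv_testToL2 _ ψ)).weakDeriv_eq]
    linarith

theorem testToL2_add (φ ψ : 𝓓(unitSquare, ℝ)) :
    testToL2 (φ + ψ) = testToL2 φ + testToL2 ψ := rfl

theorem testToL2_smul (c : ℝ) (ψ : 𝓓(unitSquare, ℝ)) :
    testToL2 (c • ψ) = c • testToL2 ψ := rfl

theorem testDeriv_add (v : ℝ × ℝ) (φ ψ : 𝓓(unitSquare, ℝ)) :
    testDeriv v (φ + ψ) = testDeriv v φ + testDeriv v ψ :=
  (isWeakDeriv_testToL2 v (φ + ψ)).unique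
    ((isWeakDeriv_testToL2 v φ).add (isWeakDeriv_testToL2 v ψ))

theorem testDeriv_smul (v : ℝ × ℝ) (c : ℝ) (ψ : 𝓓(unitSquare, ℝ)) :
    testDeriv v (c • ψ) = c • testDeriv v ψ :=
  (isWeakDeriv_testToL2 v (c • ψ)).unique ((isWeakDeriv_testToL2 v ψ).const_smul c)

theorem norm_add_sub_add_lt {a b c d : L2} {ε : ℝ} (h1 : ‖a - c‖ < ε / 2)
    (h2 : ‖b - d‖ < ε / 2) : ‖(a + b) - (c + d)‖ < ε := by
  rw [add_sub_add_comm]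
  exact (norm_add_le _ _).trans_lt (by linarith)

theorem MemH01.add {f g : L2} (hf : MemH01 f) (hg : MemH01 g) : MemH01 (f + g) := by
  rw [memH01_iff] at *
  obtain ⟨fx, fy, hfx, hfy, hf⟩ := hf
  obtain ⟨gx, gy, hgx, hgy, hg⟩ := hg
  refine ⟨_, _, hfx.add hgx, hfy.add hgy, fun ε hε => ?_⟩
  obtain ⟨φ, a1, a2, a3⟩ := hf (ε / 2) (by positivity)
  obtain ⟨ψ, b1, b2, b3⟩ := hg (ε / 2) (by positivity)
  refine ⟨φ + ψ, ?_, ?_, ?_⟩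
  · rw [testToL2_add]; exact norm_add_sub_add_lt a1 b1
  · rw [testDeriv_add]; exact norm_add_sub_add_lt a2 b2
  · rw [testDeriv_add]; exact norm_add_sub_add_lt a3 b3

theorem norm_smul_sub_smul_lt {a b : L2} {c ε : ℝ} (_ : 0 < ε) (h : ‖a - b‖ < ε / (|c| + 1)) :
    ‖c • a - c • b‖ < ε := by
  rw [← smul_sub, norm_smul, Real.norm_eq_abs]
  rw [lt_div_iff₀ (by positivity)] at h
  nlinarith [norm_nonneg (a - b)]

theorem MemH01.const_smul {f : L2} (c : ℝ) (hf : MemH01 f) : MemH01 (c • f) := by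
  rw [memH01_iff] at *
  obtain ⟨fx, fy, hfx, hfy, hf⟩ := hf
  refine ⟨_, _, hfx.const_smul c, hfy.const_smul c, fun ε hε => ?_⟩
  obtain ⟨φ, a1, a2, a3⟩ := hf (ε / (|c| + 1)) (by positivity)
  refine ⟨c • φ, ?_, ?_, ?_⟩
  · rw [testToL2_smul]; exact norm_smul_sub_smul_lt hε a1
  · rw [testDeriv_smul]; exact norm_smul_sub_smul_lt hε a2
  · rw [testDeriv_smul]; exact norm_smul_sub_smul_lt hε a3

theorem MemH01.sub {f g : L2} (hf : MemH01 f) (hg : MemH01 g) : MemH01 (f - g) := by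
  simpa [sub_eq_add_neg] using hf.add (hg.const_smul (-1))

/-- Integration by parts: the boundary term vanishes when one factor lies in the closure of the
test functions. -/
theorem IsWeakDeriv.inner_eq_neg {v : ℝ × ℝ} {w w' f f' : L2} (hw : IsWeakDeriv v w w')
    (hf : ∀ ε > 0, ∃ ψ : 𝓓(unitSquare, ℝ), ‖f - testToL2 ψ‖ < ε ∧ ‖f' - testDeriv v ψ‖ < ε) :
    inner ℝ f w' = -inner ℝ f' w := by
  rw [isWeakDeriv_iff] at hw
  rw [← sub_eq_zero, sub_neg_eq_add, ← abs_nonpos_iff]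
  refine le_of_forall_pos_le_add fun ε hε => ?_
  have hc : 0 < ‖w‖ + ‖w'‖ + 1 := by positivity
  -- The test function satisfies the identity exactly, so only the approximation errors remain, and
  -- Cauchy–Schwarz bounds them by this tolerance times `‖w‖ + ‖w'‖`. The added `1` keeps the
  -- denominator positive.
  obtain ⟨ψ, h1, h2⟩ := hf (ε / (‖w‖ + ‖w'‖ + 1)) (by positivity)
  have e : inner ℝ f w' + inner ℝ f' w
      = inner ℝ (f - testToL2 ψ) w' + inner ℝ (f' - testDeriv v ψ) w := by
    rw [inner_sub_left, inner_sub_left, hw ψ]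
    ring
  have i1 := abs_real_inner_le_norm (f - testToL2 ψ) w'
  have i2 := abs_real_inner_le_norm (f' - testDeriv v ψ) w
  rw [e, zero_add]
  refine (abs_add_le _ _).trans ?_
  have h3 : ε / (‖w‖ + ‖w'‖ + 1) * (‖w‖ + ‖w'‖ + 1) = ε := div_mul_cancel₀ _ hc.ne'
  have h4 : 0 < ε / (‖w‖ + ‖w'‖ + 1) := by positivity
  nlinarith [norm_nonneg w, norm_nonneg w', mul_le_mul_of_nonneg_right h1.le (norm_nonneg w'),
    mul_le_mul_of_nonneg_right h2.le (norm_nonneg w)]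

theorem MemH01.inner_dX {f w w' : L2} (hf : MemH01 f) (hw : IsWeakDeriv (1, 0) w w') :
    inner ℝ f w' = -inner ℝ (dX f) w := by
  obtain ⟨fx, fy, hx, hy, h⟩ := memH01_iff.1 hf
  rw [dX, hx.weakDeriv_eq]
  exact hw.inner_eq_neg fun ε hε => (h ε hε).imp fun ψ hψ => ⟨hψ.1, hψ.2.1⟩

theorem MemH01.inner_dY {f w w' : L2} (hf : MemH01 f) (hw : IsWeakDeriv (0, 1) w w') :
    inner ℝ f w' = -inner ℝ (dY f) w := by
  obtain ⟨fx, fy, hx, hy, h⟩ := memH01_iff.1 hf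
  rw [dY, hy.weakDeriv_eq]
  exact hw.inner_eq_neg fun ε hε => (h ε hε).imp fun ψ hψ => ⟨hψ.1, hψ.2.2⟩

/-! ### Completeness of the sine system -/

/-- The product `sin(jπx) sin(kπy)` with integer frequencies. -/
noncomputable def sineProd (j k : ℤ) (x : ℝ × ℝ) : ℝ :=
  Real.sin (j * Real.pi * x.1) * Real.sin (k * Real.pi * x.2)

theorem continuous_sineProd (j k : ℤ) : Continuous (sineProd j k) := by
  unfold sineProd; fun_prop

theorem integrable_mul_of_continuous (f : L2) {g : ℝ × ℝ → ℝ} (hg : Continuous g) :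
    Integrable (fun x => f x * g x) squareMeasure :=
  (Lp.memLp f).integrable_mul (memLp_of_continuous hg)

/-- `f g` is orthogonal to all products of sines. -/
def SineOrthogonal (f : L2) (g : C(ℝ × ℝ, ℝ)) : Prop :=
  ∀ j k : ℤ, ∫ x in (unitSquare : Set (ℝ × ℝ)), f x * (sineProd j k x * g x) = 0

theorem SineOrthogonal.add {f : L2} {g h : C(ℝ × ℝ, ℝ)} (hg : SineOrthogonal f g)
    (hh : SineOrthogonal f h) : SineOrthogonal f (g + h) := by
  intro j k
  have e : ∀ x, f x * (sineProd j k x * (g + h) x)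
      = f x * (sineProd j k x * g x) + f x * (sineProd j k x * h x) := fun x => by
    rw [ContinuousMap.add_apply]; ring
  have hi : ∀ p : C(ℝ × ℝ, ℝ),
      Integrable (fun x => f x * (sineProd j k x * p x)) squareMeasure := fun p =>
    integrable_mul_of_continuous f ((continuous_sineProd j k).mul p.continuous)
  simp_rw [e]
  rw [integral_add (hi g) (hi h), hg, hh, add_zero]

/-- The algebra of continuous multipliers that preserve orthogonality of `f g` to all products
of sines. -/
def sineMultipliers (f : L2) : Subalgebra ℝ C(ℝ × ℝ, ℝ) where
  carrier := {p | ∀ g, SineOrthogonal f g → SineOrthogonal f (g * p)}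
  mul_mem' := fun {p q} hp hq g hg => by
    rw [← mul_assoc]
    exact hq _ (hp _ hg)
  add_mem' := fun {p q} hp hq g hg => by
    rw [mul_add]
    exact (hp _ hg).add (hq _ hg)
  algebraMap_mem' := fun c g hg j k => by
    have e : ∀ x, f x * (sineProd j k x * (g * algebraMap ℝ C(ℝ × ℝ, ℝ) c) x)
        = c * (f x * (sineProd j k x * g x)) := fun x => by
      rw [ContinuousMap.mul_apply, show algebraMap ℝ C(ℝ × ℝ, ℝ) c x = c from rfl]
      ring
    simp_rw [e]
    rw [integral_const_mul, hg, mul_zero]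

theorem integral_mul_half_add (f : L2) {a b : ℝ × ℝ → ℝ} (ha : Continuous a) (hb : Continuous b)
    (h1 : ∫ x in (unitSquare : Set (ℝ × ℝ)), f x * a x = 0)
    (h2 : ∫ x in (unitSquare : Set (ℝ × ℝ)), f x * b x = 0) :
    ∫ x in (unitSquare : Set (ℝ × ℝ)), f x * ((1 / 2) * (a x + b x)) = 0 := by
  have e : ∀ x, f x * ((1 / 2) * (a x + b x)) = (1 / 2) * (f x * a x + f x * b x) :=
    fun x => by ring
  simp_rw [e]
  rw [integral_const_mul, integral_add (integrable_mul_of_continuous f ha)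
    (integrable_mul_of_continuous f hb), h1, h2]
  simp

theorem sin_mul_cos_shift (j : ℤ) (t : ℝ) :
    Real.sin (j * Real.pi * t) * Real.cos (Real.pi * t)
      = (1 / 2) * (Real.sin (((j + 1 : ℤ) : ℝ) * Real.pi * t)
        + Real.sin (((j - 1 : ℤ) : ℝ) * Real.pi * t)) := by
  have e1 : ((j + 1 : ℤ) : ℝ) * Real.pi * t = j * Real.pi * t + Real.pi * t := by push_cast; ring
  have e2 : ((j - 1 : ℤ) : ℝ) * Real.pi * t = j * Real.pi * t - Real.pi * t := by push_cast; ring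
  rw [e1, e2, Real.sin_add, Real.sin_sub]
  ring

/-- The product-to-sum formula turns frequency `j` into `j + 1` and `j - 1`. Allowing all integers
as frequencies makes the family closed under this shift, with no special case at `j = 1`. -/
theorem cos_fst_mem_sineMultipliers (f : L2) :
    (⟨fun x => Real.cos (Real.pi * x.1), by fun_prop⟩ : C(ℝ × ℝ, ℝ)) ∈ sineMultipliers f := by
  intro g hg j k
  convert integral_mul_half_add f ((continuous_sineProd (j + 1) k).mul g.continuous)
    ((continuous_sineProd (j - 1) k).mul g.continuous) (hg _ _) (hg _ _) using 4 with x
  simp only [sineProd, ContinuousMap.mul_apply, ContinuousMap.coe_mk, Pi.mul_apply]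
  linear_combination (Real.sin (k * Real.pi * x.2) * g x) * sin_mul_cos_shift j x.1

theorem cos_snd_mem_sineMultipliers (f : L2) :
    (⟨fun x => Real.cos (Real.pi * x.2), by fun_prop⟩ : C(ℝ × ℝ, ℝ)) ∈ sineMultipliers f := by
  intro g hg j k
  convert integral_mul_half_add f ((continuous_sineProd j (k + 1)).mul g.continuous)
    ((continuous_sineProd j (k - 1)).mul g.continuous) (hg _ _) (hg _ _) using 4 with x
  simp only [sineProd, ContinuousMap.mul_apply, ContinuousMap.coe_mk, Pi.mul_apply]
  linear_combination (Real.sin (j * Real.pi * x.1) * g x) * sin_mul_cos_shift k x.2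

/-- Injectivity makes the two cosine multipliers separate the points of the closed square. -/
theorem cos_pi_mul_injOn : InjOn (fun t => Real.cos (Real.pi * t)) (Icc 0 1) := by
  intro s hs t ht h
  have hπ := Real.pi_pos
  have := Real.injOn_cos ⟨mul_nonneg hπ.le hs.1, by nlinarith [hs.2]⟩
    ⟨mul_nonneg hπ.le ht.1, by nlinarith [ht.2]⟩ h
  exact mul_left_cancel₀ hπ.ne' this

/-- Continuous functions are uniformly approximated on the closed square by multipliers. -/
theorem exists_sineMultiplier_near (f : L2) (ψ : C(ℝ × ℝ, ℝ)) {ε : ℝ} (hε : 0 < ε) :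
    ∃ p ∈ sineMultipliers f, ∀ x ∈ Icc (0 : ℝ) 1 ×ˢ Icc (0 : ℝ) 1, |p x - ψ x| < ε := by
  let K : Set (ℝ × ℝ) := Icc (0 : ℝ) 1 ×ˢ Icc (0 : ℝ) 1
  have : CompactSpace K := isCompact_iff_compactSpace.1 (isCompact_Icc.prod isCompact_Icc)
  let r : C(ℝ × ℝ, ℝ) →⋆ₐ[ℝ] C(K, ℝ) :=
    ContinuousMap.compStarAlgHom' ℝ ℝ ⟨Subtype.val, continuous_subtype_val⟩
  -- Stone–Weierstrass is applied on the compact square, to the restrictions of the multipliers.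
  let A : Subalgebra ℝ C(K, ℝ) := (sineMultipliers f).map (r : C(ℝ × ℝ, ℝ) →ₐ[ℝ] C(K, ℝ))
  have hA : A.SeparatesPoints := by
    rintro ⟨x, hx⟩ ⟨y, hy⟩ hxy
    by_cases h1 : x.1 = y.1
    · have h2 : x.2 ≠ y.2 := fun h2 => hxy (Subtype.ext (Prod.ext h1 h2))
      refine ⟨_, ⟨_, ⟨_, cos_snd_mem_sineMultipliers f, rfl⟩, rfl⟩, ?_⟩
      exact fun h => h2 (cos_pi_mul_injOn hx.2 hy.2 h)
    · refine ⟨_, ⟨_, ⟨_, cos_fst_mem_sineMultipliers f, rfl⟩, rfl⟩, ?_⟩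
      exact fun h => h1 (cos_pi_mul_injOn hx.1 hy.1 h)
  obtain ⟨⟨_, p, hp, rfl⟩, h⟩ :=
    ContinuousMap.exists_mem_subalgebra_near_continuous_of_separatesPoints A hA
      (fun x : K => ψ x) (by fun_prop) ε hε
  exact ⟨p, hp, fun x hx => h ⟨x, hx⟩⟩

/-- For a multiplier in place of `ψ` the integral vanishes by definition. Multipliers are uniformly
dense on the square and `f` is integrable, so the general case follows in the limit. -/
theorem SineOrthogonal.integral_eq_zero {f : L2} (hf : SineOrthogonal f 1) (ψ : C(ℝ × ℝ, ℝ)) :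
    ∫ x in (unitSquare : Set (ℝ × ℝ)), f x * (sineProd 1 1 x * ψ x) = 0 := by
  have hint : Integrable (fun x => |f x|) squareMeasure :=
    ((Lp.memLp f).integrable (by norm_num)).abs
  set I := ∫ x in (unitSquare : Set (ℝ × ℝ)), |f x| with hI
  have hI0 : 0 ≤ I := integral_nonneg fun x => abs_nonneg _
  rw [← abs_nonpos_iff]
  refine le_of_forall_pos_le_add fun ε hε => ?_
  obtain ⟨p, hp, hpψ⟩ := exists_sineMultiplier_near f ψ (ε := ε / (I + 1)) (by positivity)
  have hp1 : ∫ x in (unitSquare : Set (ℝ × ℝ)), f x * (sineProd 1 1 x * p x) = 0 := by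
    simpa only [one_mul] using hp 1 hf 1 1
  have hc := continuous_sineProd 1 1
  have e : ∫ x in (unitSquare : Set (ℝ × ℝ)), f x * (sineProd 1 1 x * ψ x)
      = ∫ x in (unitSquare : Set (ℝ × ℝ)),
        (f x * (sineProd 1 1 x * ψ x) - f x * (sineProd 1 1 x * p x)) := by
    have hi : ∀ q : C(ℝ × ℝ, ℝ),
        Integrable (fun x => f x * (sineProd 1 1 x * q x)) squareMeasure := fun q =>
      integrable_mul_of_continuous f (hc.mul q.continuous)
    rw [integral_sub (hi ψ) (hi p), hp1, sub_zero]
  rw [e, zero_add, ← Real.norm_eq_abs]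
  calc _ ≤ ∫ x in (unitSquare : Set (ℝ × ℝ)), |f x| * (ε / (I + 1)) := by
        refine norm_integral_le_of_norm_le (hint.mul_const _) ?_
        filter_upwards [ae_restrict_mem unitSquare.isOpen.measurableSet] with x hx
        have h1 := hpψ x (prod_mono Ioo_subset_Icc_self Ioo_subset_Icc_self hx)
        have h2 : |sineProd 1 1 x| ≤ 1 := by
          rw [sineProd, abs_mul]
          exact mul_le_one₀ (Real.abs_sin_le_one _) (abs_nonneg _) (Real.abs_sin_le_one _)
        rw [← mul_sub, ← mul_sub, norm_mul, norm_mul, Real.norm_eq_abs, Real.norm_eq_abs,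
          Real.norm_eq_abs, abs_sub_comm]
        gcongr
        nlinarith [abs_nonneg (p x - ψ x), abs_nonneg (sineProd 1 1 x)]
    _ = I * (ε / (I + 1)) := by rw [integral_mul_const]
    _ ≤ (I + 1) * (ε / (I + 1)) := by gcongr; linarith
    _ = ε := mul_div_cancel₀ _ (by positivity)

theorem sineProd_one_one_pos {x : ℝ × ℝ} (hx : x ∈ (unitSquare : Set (ℝ × ℝ))) :
    0 < sineProd 1 1 x := by
  obtain ⟨h1, h2⟩ := hx
  have hπ := Real.pi_pos
  rw [sineProd]
  push_cast
  rw [one_mul]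
  refine mul_pos (Real.sin_pos_of_pos_of_lt_pi (mul_pos hπ h1.1) ?_)
    (Real.sin_pos_of_pos_of_lt_pi (mul_pos hπ h2.1) ?_)
  · nlinarith [h1.2]
  · nlinarith [h2.2]

/-- The product of `f` with `sin(πx) sin(πy)` annihilates all test functions, hence vanishes almost
everywhere, and the sine factor is positive on `Ω`. -/
theorem SineOrthogonal.eq_zero {f : L2} (hf : SineOrthogonal f 1) : f = 0 := by
  have hloc : LocallyIntegrableOn (fun x => f x * sineProd 1 1 x)
      (unitSquare : Set (ℝ × ℝ)) volume :=
    IntegrableOn.locallyIntegrableOn (integrable_mul_of_continuous f (continuous_sineProd 1 1))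
  have key := unitSquare.isOpen.ae_eq_zero_of_integral_contDiff_smul_eq_zero hloc (by
    intro ψ h1 h2 h3
    rw [← setIntegral_eq_integral_of_forall_compl_eq_zero
      (s := (unitSquare : Set (ℝ × ℝ)))]
    · rw [← hf.integral_eq_zero ⟨ψ, h1.continuous⟩]
      congr 1
      ext x
      simp only [smul_eq_mul, ContinuousMap.coe_mk]
      ring
    · intro x hx
      rw [image_eq_zero_of_notMem_tsupport (fun hx' => hx (h3 hx')), zero_smul])
  refine Lp.ext ((?_ : f =ᵐ[squareMeasure] 0).trans (Lp.coeFn_zero _ _ _).symm)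
  rw [Filter.EventuallyEq, ae_restrict_iff' unitSquare.isOpen.measurableSet]
  filter_upwards [key] with x hx hxm
  exact (mul_eq_zero.1 (hx hxm)).resolve_right (sineProd_one_one_pos hxm).ne'

theorem continuous_sineFun (m n : ℕ) : Continuous (sineFun m n) := by
  unfold sineFun; fun_prop

/-- Since the sine is odd, orthogonality to the modes with positive indices already gives it for all
integer frequencies. -/
theorem exists_sin_int_eq (j : ℤ) :
    (∀ t, Real.sin (j * Real.pi * t) = 0) ∨
      ∃ (m : ℕ+) (c : ℝ), ∀ t, Real.sin (j * Real.pi * t) = c * Real.sin (m * Real.pi * t) := by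
  rcases lt_trichotomy j 0 with h | rfl | h
  · refine Or.inr ⟨⟨j.natAbs, by omega⟩, -1, fun t => ?_⟩
    have : (j : ℝ) = -((j.natAbs : ℕ) : ℝ) := by
      rw [Nat.cast_natAbs, abs_of_neg h]; simp
    rw [PNat.mk_coe, this, neg_mul, neg_mul, Real.sin_neg, neg_one_mul]
  · exact Or.inl fun t => by simp
  · refine Or.inr ⟨⟨j.natAbs, by omega⟩, 1, fun t => ?_⟩
    have : (j : ℝ) = ((j.natAbs : ℕ) : ℝ) := by
      rw [Nat.cast_natAbs, abs_of_pos h]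
    rw [PNat.mk_coe, this, one_mul]

theorem sineOrthogonal_one {f : L2} (h : ∀ m n : ℕ+, inner ℝ (sineMode m n) f = 0) :
    SineOrthogonal f 1 := by
  intro j k
  simp only [ContinuousMap.one_apply, mul_one, sineProd]
  obtain hj | ⟨m, c, hj⟩ := exists_sin_int_eq j
  · simp [hj]
  obtain hk | ⟨n, d, hk⟩ := exists_sin_int_eq k
  · simp [hk]
  have e : ∀ x : ℝ × ℝ, f x * (Real.sin (j * Real.pi * x.1) * Real.sin (k * Real.pi * x.2))
      = (c * d / 2) * (f x * sineFun m n x) := fun x => by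
    rw [hj, hk, sineFun]; ring
  simp_rw [e]
  rw [integral_const_mul, ← inner_contToL2 (continuous_sineFun m n)]
  have := h m n
  rw [show contToL2 _ (continuous_sineFun m n) = sineMode m n from rfl, this, mul_zero]

/-- The eigenfunctions `φ_{m,n}` form a Hilbert basis of `L²(Ω)`. -/
noncomputable def sineBasis : HilbertBasis (ℕ+ × ℕ+) ℝ L2 :=
  HilbertBasis.mkOfOrthogonalEqBot orthonormal_sineMode (by
    rw [Submodule.eq_bot_iff]
    intro f hf
    refine (sineOrthogonal_one fun m n => ?_).eq_zero
    exact (Submodule.mem_orthogonal _ _).1 hf _ (Submodule.subset_span ⟨(m, n), rfl⟩))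

theorem sineBasis_apply (p : ℕ+ × ℕ+) : sineBasis p = sineMode p.1 p.2 := by
  rw [sineBasis, HilbertBasis.coe_mkOfOrthogonalEqBot]

theorem hasSum_sineCoeff_smul (u : L2) :
    HasSum (fun p : ℕ+ × ℕ+ => sineCoeff u p.1 p.2 • sineMode p.1 p.2) u := by
  have h := sineBasis.hasSum_repr u
  simp only [HilbertBasis.repr_apply_apply, sineBasis_apply] at h
  exact h

theorem hasSum_sineCoeff_mul (u w : L2) :
    HasSum (fun p : ℕ+ × ℕ+ => sineCoeff u p.1 p.2 * sineCoeff w p.1 p.2) (inner ℝ u w) := by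
  have h := sineBasis.hasSum_inner_mul_inner u w
  simp only [sineBasis_apply] at h
  simpa only [sineCoeff, real_inner_comm u] using h

/-! ### Cutoffs near the boundary: the modes lie in `H₀¹(Ω)` -/

theorem tendsto_contToL2 {F : ℕ → ℝ × ℝ → ℝ} {G : ℝ × ℝ → ℝ} (hF : ∀ k, Continuous (F k))
    (hG : Continuous G) {C : ℝ} (hC : ∀ k, ∀ x ∈ (unitSquare : Set (ℝ × ℝ)), |F k x| ≤ C)
    (hlim : ∀ x ∈ (unitSquare : Set (ℝ × ℝ)), Tendsto (fun k => F k x) atTop (𝓝 (G x))) :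
    Tendsto (fun k => ‖contToL2 G hG - contToL2 (F k) (hF k)‖) atTop (𝓝 0) := by
  have hsub : ∀ k, Continuous fun x => G x - F k x := fun k => hG.sub (hF k)
  have e : ∀ k, ‖contToL2 G hG - contToL2 (F k) (hF k)‖
      = √(∫ x in (unitSquare : Set (ℝ × ℝ)), (G x - F k x) ^ 2) := fun k => by
    rw [show contToL2 G hG - contToL2 (F k) (hF k) = contToL2 _ (hsub k) from rfl,
      norm_eq_sqrt_real_inner, inner_contToL2]
    congr 1
    refine integral_congr_ae ?_
    filter_upwards [coeFn_contToL2 (hsub k)] with x hx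
    rw [hx, sq]
  simp_rw [e]
  rw [← Real.sqrt_zero]
  refine (Real.continuous_sqrt.tendsto 0).comp ?_
  rw [show (0 : ℝ) = ∫ x in (unitSquare : Set (ℝ × ℝ)), (0 : ℝ) by simp]
  refine tendsto_integral_of_dominated_convergence (fun _ => (2 * C) ^ 2)
    (fun k => ((hsub k).pow 2).aestronglyMeasurable) (integrable_const _) (fun k => ?_) ?_
  · filter_upwards [ae_restrict_mem unitSquare.isOpen.measurableSet] with x hx
    have hGx : |G x| ≤ C := le_of_tendsto (hlim x hx).abs (Eventually.of_forall fun k => hC k x hx)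
    have h := (abs_sub (G x) (F k x)).trans (add_le_add hGx (hC k x hx))
    rw [Real.norm_eq_abs, abs_pow]
    gcongr
    linarith
  · filter_upwards [ae_restrict_mem unitSquare.isOpen.measurableSet] with x hx
    simpa using ((hlim x hx).const_sub (G x)).pow 2

theorem deriv_smoothTransition_eq_zero {s : ℝ} (hs : s ∉ Icc (0 : ℝ) 1) :
    deriv Real.smoothTransition s = 0 := by
  rw [mem_Icc, not_and_or, not_le, not_le] at hs
  rcases hs with h | h
  · have : Real.smoothTransition =ᶠ[𝓝 s] fun _ => 0 := by
      filter_upwards [gt_mem_nhds h] with t ht using Real.smoothTransition.zero_of_nonpos ht.le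
    rw [this.deriv_eq, deriv_const]
  · have : Real.smoothTransition =ᶠ[𝓝 s] fun _ => 1 := by
      filter_upwards [lt_mem_nhds h] with t ht using Real.smoothTransition.one_of_one_le ht.le
    rw [this.deriv_eq, deriv_const]

/-- The weight `s + 1` is chosen for `s = k r - 1`, where it equals `k r`: the factor `k` from the
chain rule is absorbed by the distance `r` to an end point, uniformly in `k`. The bound holds
because the derivative is supported in `[0, 1]`. -/
theorem exists_bound_deriv_smoothTransition :
    ∃ B : ℝ, 0 ≤ B ∧ ∀ s, |(s + 1) * deriv Real.smoothTransition s| ≤ B := by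
  have hc : Continuous fun s : ℝ => (s + 1) * deriv Real.smoothTransition s :=
    (continuous_id.add continuous_const).mul
      ((Real.smoothTransition.contDiff (n := 1)).continuous_deriv le_rfl)
  obtain ⟨B, hB⟩ := isCompact_Icc.exists_bound_of_continuousOn (s := Icc (0 : ℝ) 1) hc.continuousOn
  have hB0 : 0 ≤ B := (norm_nonneg _).trans (hB 0 ⟨le_rfl, zero_le_one⟩)
  refine ⟨B, hB0, fun s => ?_⟩
  by_cases hs : s ∈ Icc (0 : ℝ) 1
  · exact hB s hs
  · rwa [deriv_smoothTransition_eq_zero hs, mul_zero, abs_zero]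

/-- A smooth cutoff function of the unit interval, equal to `1` at distance at least `2 / k` from
the end points. -/
noncomputable def intervalCutoff (k : ℕ) (t : ℝ) : ℝ :=
  Real.smoothTransition (k * t - 1) * Real.smoothTransition (k * (1 - t) - 1)

theorem contDiff_intervalCutoff (k : ℕ) : ContDiff ℝ ∞ (intervalCutoff k) := by
  unfold intervalCutoff
  exact (Real.smoothTransition.contDiff.comp (by fun_prop)).mul
    (Real.smoothTransition.contDiff.comp (by fun_prop))

theorem abs_intervalCutoff_le_one (k : ℕ) (t : ℝ) : |intervalCutoff k t| ≤ 1 := by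
  rw [intervalCutoff, abs_mul, abs_of_nonneg (Real.smoothTransition.nonneg _),
    abs_of_nonneg (Real.smoothTransition.nonneg _)]
  exact mul_le_one₀ (Real.smoothTransition.le_one _) (Real.smoothTransition.nonneg _)
    (Real.smoothTransition.le_one _)

theorem exists_compact_intervalCutoff (k : ℕ) :
    ∃ K : Set ℝ, IsCompact K ∧ K ⊆ Ioo 0 1 ∧ ∀ t ∉ K, intervalCutoff k t = 0 := by
  have hk : (0 : ℝ) ≤ k := k.cast_nonneg
  have hsub : {t : ℝ | 1 ≤ k * t ∧ 1 ≤ k * (1 - t)} ⊆ Ioo 0 1 := by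
    rintro t ⟨h1, h2⟩
    constructor
    · by_contra! h
      nlinarith
    · by_contra! h
      nlinarith
  refine ⟨_, isCompact_Icc.of_isClosed_subset ?_ (hsub.trans Ioo_subset_Icc_self), hsub, ?_⟩
  · exact (isClosed_le (g := fun t : ℝ => k * t) continuous_const (by fun_prop)).inter
      (isClosed_le (g := fun t : ℝ => k * (1 - t)) continuous_const (by fun_prop))
  · intro t ht
    rw [mem_ofPred_eq, not_and_or, not_le, not_le] at ht
    rw [intervalCutoff, mul_eq_zero, Real.smoothTransition.zero_iff_nonpos,
      Real.smoothTransition.zero_iff_nonpos]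
    exact ht.imp (fun h => by linarith) (fun h => by linarith)

theorem eventually_intervalCutoff_eq_one {t : ℝ} (ht : t ∈ Ioo (0 : ℝ) 1) :
    ∀ᶠ k : ℕ in atTop, intervalCutoff k =ᶠ[𝓝 t] fun _ => 1 := by
  have h1 : ∀ᶠ k : ℕ in atTop, 2 < (k : ℝ) * t :=
    (tendsto_natCast_atTop_atTop.atTop_mul_const ht.1).eventually_gt_atTop 2
  have h2 : ∀ᶠ k : ℕ in atTop, 2 < (k : ℝ) * (1 - t) :=
    (tendsto_natCast_atTop_atTop.atTop_mul_const (sub_pos.2 ht.2)).eventually_gt_atTop 2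
  filter_upwards [h1, h2] with k h1 h2
  have c1 : ContinuousAt (fun s : ℝ => (k : ℝ) * s) t := by fun_prop
  have c2 : ContinuousAt (fun s : ℝ => (k : ℝ) * (1 - s)) t := by fun_prop
  filter_upwards [c1.eventually_const_lt h1, c2.eventually_const_lt h2] with s h3 h4
  rw [intervalCutoff, Real.smoothTransition.one_of_one_le (by linarith),
    Real.smoothTransition.one_of_one_le (by linarith), mul_one]

theorem deriv_intervalCutoff (k : ℕ) (t : ℝ) :
    deriv (intervalCutoff k) t
      = k * deriv Real.smoothTransition (k * t - 1) * Real.smoothTransition (k * (1 - t) - 1)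
        - Real.smoothTransition (k * t - 1) *
          (k * deriv Real.smoothTransition (k * (1 - t) - 1)) := by
  have hd : ∀ s, HasDerivAt Real.smoothTransition (deriv Real.smoothTransition s) s := fun s =>
    ((Real.smoothTransition.contDiff (n := 1)).differentiable one_ne_zero s).hasDerivAt
  have h1 : HasDerivAt (fun t : ℝ => (k : ℝ) * t - 1) k t := by
    simpa using ((hasDerivAt_id t).const_mul (k : ℝ)).sub_const 1
  have h2 : HasDerivAt (fun t : ℝ => (k : ℝ) * (1 - t) - 1) (-k) t := by
    simpa using (((hasDerivAt_id t).const_sub 1).const_mul (k : ℝ)).sub_const 1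
  have := (((hd _).comp t h1).mul ((hd _).comp t h2)).deriv
  refine Eq.trans this ?_
  simp only [Function.comp_apply]
  ring

/-- The derivative of the cutoff is of order `k`, but it lives within `2 / k` of the end points,
where a function vanishing linearly is of order `1 / k`. -/
theorem exists_bound_deriv_intervalCutoff_mul {s : ℝ → ℝ} {L : ℝ}
    (h0 : ∀ t ∈ Ioo (0 : ℝ) 1, |s t| ≤ L * t) (h1 : ∀ t ∈ Ioo (0 : ℝ) 1, |s t| ≤ L * (1 - t)) :
    ∃ C : ℝ, ∀ k : ℕ, ∀ t ∈ Ioo (0 : ℝ) 1, |deriv (intervalCutoff k) t * s t| ≤ C := by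
  obtain ⟨B, hB0, hB⟩ := exists_bound_deriv_smoothTransition
  have hL : 0 ≤ L := by
    have := (abs_nonneg _).trans (h0 (1 / 2) ⟨by norm_num, by norm_num⟩)
    linarith
  -- One of the two terms of the product rule; `r` is the distance to the relevant end point and `T`
  -- is the undifferentiated factor.
  have key : ∀ (k : ℕ) (r T y : ℝ), 0 ≤ r → |T| ≤ 1 → |y| ≤ L * r →
      |k * deriv Real.smoothTransition (k * r - 1) * T * y| ≤ L * B := by
    intro k r T y hr hT hy
    have hb := hB (k * r - 1)
    rw [sub_add_cancel, abs_mul, abs_mul, Nat.abs_cast, abs_of_nonneg hr] at hb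
    rw [abs_mul, abs_mul, abs_mul, Nat.abs_cast]
    calc _ ≤ k * |deriv Real.smoothTransition (k * r - 1)| * 1 * (L * r) := by gcongr
      _ = L * (k * r * |deriv Real.smoothTransition (k * r - 1)|) := by ring
      _ ≤ L * B := by gcongr
  have hT : ∀ r, |Real.smoothTransition r| ≤ 1 := fun r => by
    rw [abs_of_nonneg (Real.smoothTransition.nonneg _)]
    exact Real.smoothTransition.le_one _
  refine ⟨L * B + L * B, fun k t ht => ?_⟩
  rw [deriv_intervalCutoff, sub_mul]
  refine (abs_sub _ _).trans (add_le_add (key k t _ _ ht.1.le (hT _) (h0 t ht)) ?_)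
  rw [mul_comm (Real.smoothTransition _)]
  exact key k (1 - t) _ _ (sub_nonneg.2 ht.2.le) (hT _) (h1 t ht)

/-- The truncation of `sin(mπt)` near the end points of the unit interval. -/
noncomputable def cutSine (m k : ℕ) (t : ℝ) : ℝ :=
  intervalCutoff k t * Real.sin (m * Real.pi * t)

theorem contDiff_cutSine (m k : ℕ) : ContDiff ℝ ∞ (cutSine m k) :=
  (contDiff_intervalCutoff k).mul (Real.contDiff_sin.comp (by fun_prop))

theorem hasDerivAt_sin_mul (a t : ℝ) :
    HasDerivAt (fun t => Real.sin (a * t)) (a * Real.cos (a * t)) t := by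
  simpa [mul_comm] using ((hasDerivAt_id t).const_mul a).sin

theorem abs_cutSine_le_one (m k : ℕ) (t : ℝ) : |cutSine m k t| ≤ 1 := by
  rw [cutSine, abs_mul]
  exact mul_le_one₀ (abs_intervalCutoff_le_one k t) (abs_nonneg _) (Real.abs_sin_le_one _)

theorem exists_bound_deriv_cutSine (m : ℕ) :
    ∃ C : ℝ, ∀ k : ℕ, ∀ t ∈ Ioo (0 : ℝ) 1, |deriv (cutSine m k) t| ≤ C := by
  have hmπ : 0 ≤ m * Real.pi := by positivity
  obtain ⟨C, hC⟩ := exists_bound_deriv_intervalCutoff_mul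
    (s := fun t => Real.sin (m * Real.pi * t)) (L := m * Real.pi)
    (fun t ht => by
      refine (Real.abs_sin_le_abs).trans_eq (abs_of_nonneg (mul_nonneg hmπ ht.1.le)))
    (fun t ht => by
      -- Reflection in the midpoint changes only the sign because `sin(mπ) = 0`. This transfers
      -- linear vanishing from the end point `0` to the end point `1`.
      have e : |Real.sin (m * Real.pi * t)| = |Real.sin (m * Real.pi * (1 - t))| := by
        rw [mul_sub, mul_one, Real.sin_sub, Real.sin_nat_mul_pi, zero_mul, zero_sub, abs_neg,
          abs_mul, Real.abs_cos_eq_sqrt_one_sub_sin_sq, Real.sin_nat_mul_pi]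
        simp
      rw [e]
      exact Real.abs_sin_le_abs.trans_eq (abs_of_nonneg (mul_nonneg hmπ (sub_nonneg.2 ht.2.le))))
  refine ⟨C + m * Real.pi, fun k t ht => ?_⟩
  have hd : HasDerivAt (cutSine m k) _ t :=
    ((contDiff_intervalCutoff k).differentiable (by simp) t).hasDerivAt.mul
      (hasDerivAt_sin_mul (m * Real.pi) t)
  rw [hd.deriv]
  refine (abs_add_le _ _).trans (add_le_add (hC k t ht) ?_)
  rw [abs_mul, abs_mul, abs_of_nonneg hmπ]
  have h1 := abs_intervalCutoff_le_one k t
  have h2 := Real.abs_cos_le_one (m * Real.pi * t)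
  calc _ ≤ 1 * (m * Real.pi * 1) := by gcongr
    _ = _ := by ring

theorem eventually_cutSine_eq (m : ℕ) {t : ℝ} (ht : t ∈ Ioo (0 : ℝ) 1) :
    ∀ᶠ k : ℕ in atTop, cutSine m k t = Real.sin (m * Real.pi * t) ∧
      deriv (cutSine m k) t = m * Real.pi * Real.cos (m * Real.pi * t) := by
  filter_upwards [eventually_intervalCutoff_eq_one ht] with k hk
  have h : cutSine m k =ᶠ[𝓝 t] fun t => Real.sin (m * Real.pi * t) := by
    filter_upwards [hk] with s hs
    rw [cutSine, hs, one_mul]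
  exact ⟨h.eq_of_nhds, by rw [h.deriv_eq, (hasDerivAt_sin_mul _ t).deriv]⟩

/-- A product `2 a(x) b(y)` of functions of one variable. -/
def tensorFun (a b : ℝ → ℝ) (x : ℝ × ℝ) : ℝ := 2 * a x.1 * b x.2

theorem contDiff_tensorFun {a b : ℝ → ℝ} (ha : ContDiff ℝ ∞ a) (hb : ContDiff ℝ ∞ b) :
    ContDiff ℝ ∞ (tensorFun a b) := by
  unfold tensorFun; fun_prop

theorem fderiv_tensorFun {a b : ℝ → ℝ} {x : ℝ × ℝ} (ha : DifferentiableAt ℝ a x.1)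
    (hb : DifferentiableAt ℝ b x.2) :
    fderiv ℝ (tensorFun a b) x (1, 0) = 2 * deriv a x.1 * b x.2 ∧
      fderiv ℝ (tensorFun a b) x (0, 1) = 2 * a x.1 * deriv b x.2 := by
  have h : HasFDerivAt (tensorFun a b) _ x :=
    ((ha.hasDerivAt.comp_hasFDerivAt x (hasFDerivAt_fst (𝕜 := ℝ) (p := x))).const_mul 2).mul
      (hb.hasDerivAt.comp_hasFDerivAt x (hasFDerivAt_snd (𝕜 := ℝ) (p := x)))
  rw [h.fderiv]
  constructor
  · simp
    ring
  · simp

theorem abs_two_mul_mul_le {a b A B : ℝ} (ha : |a| ≤ A) (hb : |b| ≤ B) :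
    |2 * a * b| ≤ 2 * A * B := by
  rw [abs_mul, abs_mul, abs_two]
  have := (abs_nonneg a).trans ha
  gcongr

/-- The truncation of `φ_{m,n}` near the boundary of the square. -/
noncomputable def cutMode (m n k : ℕ) : 𝓓(unitSquare, ℝ) where
  toFun := tensorFun (cutSine m k) (cutSine n k)
  contDiff' := contDiff_tensorFun (contDiff_cutSine m k) (contDiff_cutSine n k)
  hasCompactSupport' := by
    obtain ⟨K, hK, -, h⟩ := exists_compact_intervalCutoff k
    refine HasCompactSupport.intro (hK.prod hK) fun x hx => ?_
    rw [mem_prod, not_and_or] at hx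
    rcases hx with hx | hx <;> simp [tensorFun, cutSine, h _ hx]
  tsupport_subset' := by
    obtain ⟨K, hK, hsub, h⟩ := exists_compact_intervalCutoff k
    refine (closure_minimal (fun x hx => ?_) (hK.prod hK).isClosed).trans (prod_mono hsub hsub)
    by_contra hx'
    rw [mem_prod, not_and_or] at hx'
    refine hx ?_
    rcases hx' with hx' | hx' <;> simp [tensorFun, cutSine, h _ hx']

theorem contDiff_sineFun (m n : ℕ) : ContDiff ℝ ∞ (sineFun m n) := by
  unfold sineFun; fun_prop

theorem fderiv_sineFun (m n : ℕ) (x : ℝ × ℝ) :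
    fderiv ℝ (sineFun m n) x (1, 0)
        = 2 * (m * Real.pi * Real.cos (m * Real.pi * x.1)) * Real.sin (n * Real.pi * x.2) ∧
      fderiv ℝ (sineFun m n) x (0, 1)
        = 2 * Real.sin (m * Real.pi * x.1) * (n * Real.pi * Real.cos (n * Real.pi * x.2)) := by
  have h := fderiv_tensorFun (x := x) (hasDerivAt_sin_mul (m * Real.pi) x.1).differentiableAt
    (hasDerivAt_sin_mul (n * Real.pi) x.2).differentiableAt
  rwa [(hasDerivAt_sin_mul _ _).deriv, (hasDerivAt_sin_mul _ _).deriv] at h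

theorem isWeakDeriv_sineMode (m n : ℕ) (v : ℝ × ℝ) :
    IsWeakDeriv v (sineMode m n)
      (contToL2 (fun x => fderiv ℝ (sineFun m n) x v)
        (continuous_fderiv_apply (contDiff_sineFun m n) v)) :=
  isWeakDeriv_contToL2 (contDiff_sineFun m n) v

/-- At each interior point the truncations and their first derivatives are eventually equal to those
of the mode, and they are bounded uniformly in `k`. Dominated convergence then gives `L²`
convergence of the function and of both partial derivatives. -/
theorem memH01_sineMode (m n : ℕ) : MemH01 (sineMode m n) := by
  refine memH01_iff.2 ⟨_, _, isWeakDeriv_sineMode m n (1, 0), isWeakDeriv_sineMode m n (0, 1),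
    fun ε hε => ?_⟩
  obtain ⟨Cm, hCm⟩ := exists_bound_deriv_cutSine m
  obtain ⟨Cn, hCn⟩ := exists_bound_deriv_cutSine n
  have hd : ∀ m k t, DifferentiableAt ℝ (cutSine m k) t := fun m k t =>
    (contDiff_cutSine m k).differentiable (by simp) t
  have hf := fun k x => fderiv_tensorFun (x := x) (hd m k x.1) (hd n k x.2)
  have h1 := tendsto_contToL2 (F := fun k => cutMode m n k) (C := 2 * 1 * 1)
    (fun k => (cutMode m n k).continuous) (contDiff_sineFun m n).continuous
    (fun k x hx => abs_two_mul_mul_le (abs_cutSine_le_one m k x.1) (abs_cutSine_le_one n k x.2))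
    (fun x hx => by
      refine tendsto_const_nhds.congr' ?_
      filter_upwards [eventually_cutSine_eq m hx.1, eventually_cutSine_eq n hx.2] with k hm hn
      change sineFun m n x = 2 * cutSine m k x.1 * cutSine n k x.2
      rw [hm.1, hn.1, sineFun])
  have h2 := tendsto_contToL2 (F := fun k x => fderiv ℝ (cutMode m n k) x (1, 0))
    (C := 2 * Cm * 1)
    (fun k => continuous_fderiv_apply (cutMode m n k).contDiff (1, 0))
    (continuous_fderiv_apply (contDiff_sineFun m n) (1, 0))
    (fun k x hx => by
      refine (congrArg abs (hf k x).1).trans_le ?_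
      exact abs_two_mul_mul_le (hCm k x.1 hx.1) (abs_cutSine_le_one n k x.2))
    (fun x hx => by
      refine tendsto_const_nhds.congr' ?_
      filter_upwards [eventually_cutSine_eq m hx.1, eventually_cutSine_eq n hx.2] with k hm hn
      refine Eq.trans ?_ (hf k x).1.symm
      rw [hm.2, hn.1, (fderiv_sineFun m n x).1])
  have h3 := tendsto_contToL2 (F := fun k x => fderiv ℝ (cutMode m n k) x (0, 1))
    (C := 2 * 1 * Cn)
    (fun k => continuous_fderiv_apply (cutMode m n k).contDiff (0, 1))
    (continuous_fderiv_apply (contDiff_sineFun m n) (0, 1))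
    (fun k x hx => by
      refine (congrArg abs (hf k x).2).trans_le ?_
      exact abs_two_mul_mul_le (abs_cutSine_le_one m k x.1) (hCn k x.2 hx.2))
    (fun x hx => by
      refine tendsto_const_nhds.congr' ?_
      filter_upwards [eventually_cutSine_eq m hx.1, eventually_cutSine_eq n hx.2] with k hm hn
      refine Eq.trans ?_ (hf k x).2.symm
      rw [hm.1, hn.2, (fderiv_sineFun m n x).2])
  obtain ⟨k, a1, a2, a3⟩ := ((h1.eventually_lt_const hε).and
    ((h2.eventually_lt_const hε).and (h3.eventually_lt_const hε))).exists
  exact ⟨cutMode m n k, a1, a2, a3⟩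

/-! ### The weak Laplacian on `H₀¹(Ω)` and Green's identities -/

/-- `F` is the weak Laplacian of `f`, obtained from second order weak derivatives in `L²(Ω)`. -/
def HasLaplacian (f F : L2) : Prop :=
  ∃ fx fxx fy fyy : L2, IsWeakDeriv (1, 0) f fx ∧ IsWeakDeriv (1, 0) fx fxx ∧
    IsWeakDeriv (0, 1) f fy ∧ IsWeakDeriv (0, 1) fy fyy ∧ F = fxx + fyy

theorem MemH2.hasLaplacian {u : L2} (h : MemH2 u) : HasLaplacian u (dX (dX u) + dY (dY u)) :=
  ⟨_, _, _, _, h.1.isWeakDeriv_dX, h.2.1.isWeakDeriv_dX, h.1.isWeakDeriv_dY,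
    h.2.2.isWeakDeriv_dY, rfl⟩

theorem HasLaplacian.add {f g F G : L2} (hf : HasLaplacian f F) (hg : HasLaplacian g G) :
    HasLaplacian (f + g) (F + G) := by
  obtain ⟨_, _, _, _, f1, f2, f3, f4, rfl⟩ := hf
  obtain ⟨_, _, _, _, g1, g2, g3, g4, rfl⟩ := hg
  exact ⟨_, _, _, _, f1.add g1, f2.add g2, f3.add g3, f4.add g4, add_add_add_comm _ _ _ _⟩

theorem HasLaplacian.const_smul {f F : L2} (c : ℝ) (hf : HasLaplacian f F) :
    HasLaplacian (c • f) (c • F) := by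
  obtain ⟨_, _, _, _, f1, f2, f3, f4, rfl⟩ := hf
  exact ⟨_, _, _, _, f1.const_smul c, f2.const_smul c, f3.const_smul c, f4.const_smul c,
    smul_add _ _ _⟩

theorem HasLaplacian.inner_self {f F : L2} (hF : HasLaplacian f F) (hf : MemH01 f) :
    inner ℝ f F = -normH01 f ^ 2 := by
  obtain ⟨_, _, _, _, f1, f2, f3, f4, rfl⟩ := hF
  rw [normH01, Real.sq_sqrt (by positivity), inner_add_right, hf.inner_dX f2, hf.inner_dY f4,
    dX, dY, f1.weakDeriv_eq, f3.weakDeriv_eq, real_inner_self_eq_norm_sq,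
    real_inner_self_eq_norm_sq]
  ring

/-- Both sides equal `-∫ ∇f · ∇g`, since membership in `H₀¹` removes the boundary terms. -/
theorem HasLaplacian.inner_comm {f F g G : L2} (hF : HasLaplacian f F) (hG : HasLaplacian g G)
    (hf : MemH01 f) (hg : MemH01 g) : inner ℝ f G = inner ℝ g F := by
  obtain ⟨fx, _, fy, _, f1, f2, f3, f4, rfl⟩ := hF
  obtain ⟨gx, _, gy, _, g1, g2, g3, g4, rfl⟩ := hG
  rw [inner_add_right, inner_add_right, hf.inner_dX g2, hf.inner_dY g4, hg.inner_dX f2,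
    hg.inner_dY f4, dX, dY, dX, dY, f1.weakDeriv_eq, f3.weakDeriv_eq, g1.weakDeriv_eq,
    g3.weakDeriv_eq, real_inner_comm gx, real_inner_comm gy]

theorem hasDerivAt_mul_cos_mul (a t : ℝ) :
    HasDerivAt (fun t => a * Real.cos (a * t)) (-a ^ 2 * Real.sin (a * t)) t := by
  refine (((hasDerivAt_id t).const_mul a).cos.const_mul a).congr_deriv ?_
  simp only [id_eq]
  ring

theorem hasLaplacian_sineMode (m n : ℕ) :
    HasLaplacian (sineMode m n) (-dirichletEigenvalue m n • sineMode m n) := by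
  have hx := isWeakDeriv_sineMode m n (1, 0)
  have hy := isWeakDeriv_sineMode m n (0, 1)
  have ex : (fun x => fderiv ℝ (sineFun m n) x (1, 0))
      = tensorFun (fun t => m * Real.pi * Real.cos (m * Real.pi * t))
        (fun t => Real.sin (n * Real.pi * t)) := funext fun x => (fderiv_sineFun m n x).1
  have ey : (fun x => fderiv ℝ (sineFun m n) x (0, 1))
      = tensorFun (fun t => Real.sin (m * Real.pi * t))
        (fun t => n * Real.pi * Real.cos (n * Real.pi * t)) :=
    funext fun x => (fderiv_sineFun m n x).2
  have cx : ContDiff ℝ ∞ (fun x => fderiv ℝ (sineFun m n) x (1, 0)) := by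
    rw [ex]; exact contDiff_tensorFun (by fun_prop) (by fun_prop)
  have cy : ContDiff ℝ ∞ (fun x => fderiv ℝ (sineFun m n) x (0, 1)) := by
    rw [ey]; exact contDiff_tensorFun (by fun_prop) (by fun_prop)
  refine ⟨_, _, _, _, hx, isWeakDeriv_contToL2 cx (1, 0), hy, isWeakDeriv_contToL2 cy (0, 1), ?_⟩
  have e : (fun x => -dirichletEigenvalue m n * sineFun m n x)
      = fun x => fderiv ℝ (fun x => fderiv ℝ (sineFun m n) x (1, 0)) x (1, 0)
        + fderiv ℝ (fun x => fderiv ℝ (sineFun m n) x (0, 1)) x (0, 1) := by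
    ext x
    rw [ex, ey, (fderiv_tensorFun (hasDerivAt_mul_cos_mul _ _).differentiableAt
        (hasDerivAt_sin_mul _ _).differentiableAt).1,
      (fderiv_tensorFun (hasDerivAt_sin_mul _ _).differentiableAt
        (hasDerivAt_mul_cos_mul _ _).differentiableAt).2,
      (hasDerivAt_mul_cos_mul _ _).deriv, (hasDerivAt_mul_cos_mul _ _).deriv,
      dirichletEigenvalue, sineFun]
    ring
  rw [← contToL2_add, show sineMode m n = contToL2 _ (continuous_sineFun m n) from rfl,
    ← contToL2_smul _ (continuous_sineFun m n)]
  congr 1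

/-- Symmetry moves the Laplacian onto the mode, an eigenfunction that also lies in `H₀¹`. -/
theorem HasLaplacian.sineCoeff_eq {f F : L2} (hF : HasLaplacian f F) (hf : MemH01 f) (m n : ℕ) :
    sineCoeff F m n = -dirichletEigenvalue m n * sineCoeff f m n := by
  rw [sineCoeff, sineCoeff, ← hF.inner_comm (hasLaplacian_sineMode m n) hf (memH01_sineMode m n),
    inner_smul_right, real_inner_comm]

theorem memH01_zero : MemH01 0 := by
  simpa using (memH01_sineMode 0 0).const_smul 0

theorem memH01_sum {ι : Type*} (s : Finset ι) {f : ι → L2} (h : ∀ i, MemH01 (f i)) :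
    MemH01 (∑ i ∈ s, f i) :=
  Finset.sum_induction f MemH01 (fun _ _ => MemH01.add) memH01_zero fun i _ => h i

theorem memH01_spectralProj (M : ℕ) (u : L2) : MemH01 (spectralProj M u) :=
  memH01_sum _ fun m => memH01_sum _ fun n => (memH01_sineMode m n).const_smul _

theorem exists_hasLaplacian_sum {ι : Type*} (s : Finset ι) {f : ι → L2}
    (h : ∀ i, ∃ F, HasLaplacian (f i) F) : ∃ F, HasLaplacian (∑ i ∈ s, f i) F :=
  Finset.sum_induction f (fun f => ∃ F, HasLaplacian f F)
    (fun _ _ ⟨_, hf⟩ ⟨_, hg⟩ => ⟨_, hf.add hg⟩)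
    ⟨_, by simpa using (hasLaplacian_sineMode 0 0).const_smul 0⟩ fun i _ => h i

theorem exists_hasLaplacian_spectralProj (M : ℕ) (u : L2) :
    ∃ F, HasLaplacian (spectralProj M u) F :=
  exists_hasLaplacian_sum _ fun m => exists_hasLaplacian_sum _ fun n =>
    ⟨_, (hasLaplacian_sineMode m n).const_smul _⟩

/-! ### Coefficients of the remainder and the spectral gap -/

theorem inner_sineMode (p q : ℕ+ × ℕ+) :
    inner ℝ (sineMode p.1 p.2) (sineMode q.1 q.2) = if p = q then (1 : ℝ) else 0 :=
  orthonormal_iff_ite.1 orthonormal_sineMode p q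

theorem sineCoeff_spectralProj (M : ℕ) (u : L2) (p : ℕ+ × ℕ+) :
    sineCoeff (spectralProj M u) p.1 p.2
      = if (p.1 : ℕ) ≤ M ∧ (p.2 : ℕ) ≤ M then sineCoeff u p.1 p.2 else 0 := by
  have h : ∀ m ∈ Finset.Icc 1 M, ∀ n ∈ Finset.Icc 1 M,
      inner ℝ (sineMode p.1 p.2) (sineCoeff u m n • sineMode m n)
        = if (p.1 : ℕ) = m then (if (p.2 : ℕ) = n then sineCoeff u m n else 0) else 0 := by
    intro m hm n hn
    have e := inner_sineMode p
      (⟨m, (Finset.mem_Icc.1 hm).1⟩, ⟨n, (Finset.mem_Icc.1 hn).1⟩)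
    simp only [PNat.mk_coe] at e
    rw [inner_smul_right, e]
    have : p = (⟨m, (Finset.mem_Icc.1 hm).1⟩, ⟨n, (Finset.mem_Icc.1 hn).1⟩)
        ↔ (p.1 : ℕ) = m ∧ (p.2 : ℕ) = n := by
      rw [Prod.ext_iff, ← PNat.coe_inj, ← PNat.coe_inj]; rfl
    simp only [this, ite_and, mul_ite, mul_one, mul_zero]
  rw [sineCoeff, spectralProj, inner_sum]
  simp_rw [inner_sum]
  rw [Finset.sum_congr rfl fun m hm => Finset.sum_congr rfl (h m hm)]
  have h1 := p.1.pos
  have h2 := p.2.pos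
  by_cases a : (p.1 : ℕ) ≤ M <;> by_cases b : (p.2 : ℕ) ≤ M <;>
    simp [Finset.sum_ite_irrel, a, b, Nat.one_le_iff_ne_zero]

theorem sineCoeff_sub (u w : L2) (m n : ℕ) :
    sineCoeff (u - w) m n = sineCoeff u m n - sineCoeff w m n :=
  inner_sub_right _ _ _

theorem hasSum_sineCoeff_sq (u : L2) :
    HasSum (fun p : ℕ+ × ℕ+ => sineCoeff u p.1 p.2 ^ 2) (‖u‖ ^ 2) := by
  simpa only [← sq, real_inner_self_eq_norm_sq] using hasSum_sineCoeff_mul u u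

/-- The remainder of the spectral projection has a Laplacian of smaller norm. -/
theorem HasLaplacian.norm_remainder_le {u F V : L2} {M : ℕ} (hF : HasLaplacian u F)
    (hu : MemH01 u) (hV : HasLaplacian (u - spectralProj M u) V) : ‖V‖ ≤ ‖F‖ := by
  refine le_of_sq_le_sq ?_ (norm_nonneg _)
  -- By Parseval it suffices to compare coefficients: those of `V` vanish inside the box and agree
  -- with those of `F` outside.
  refine hasSum_le (fun p => ?_) (hasSum_sineCoeff_sq V) (hasSum_sineCoeff_sq F)
  rw [hV.sineCoeff_eq (hu.sub (memH01_spectralProj M u)), hF.sineCoeff_eq hu, sineCoeff_sub,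
    sineCoeff_spectralProj, mul_pow, mul_pow]
  gcongr ?_ * ?_
  split_ifs
  · rw [sub_self, zero_pow two_ne_zero]; positivity
  · rw [sub_zero]

/-- The spectral gap above the box of frequencies at most `M`. -/
theorem HasLaplacian.mul_norm_remainder_le {u V : L2} {M : ℕ} (hu : MemH01 u)
    (hV : HasLaplacian (u - spectralProj M u) V) :
    Real.pi ^ 2 * M ^ 2 * ‖u - spectralProj M u‖ ≤ ‖V‖ := by
  refine le_of_sq_le_sq ?_ (norm_nonneg _)
  rw [mul_pow _ ‖_‖]
  refine hasSum_le (fun p => ?_) ((hasSum_sineCoeff_sq _).mul_left _) (hasSum_sineCoeff_sq V)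
  rw [hV.sineCoeff_eq (hu.sub (memH01_spectralProj M u)), sineCoeff_sub,
    sineCoeff_spectralProj, mul_pow (-_), neg_sq]
  split_ifs with h
  · simp
  -- Outside the box at least one index exceeds `M`, so `m² + n² ≥ M²`.
  · gcongr ?_ ^ 2 * _
    rw [dirichletEigenvalue]
    gcongr
    rw [not_and_or, not_le, not_le] at h
    rcases h with h | h
    · have : (M : ℝ) ≤ (p.1 : ℕ) := by exact_mod_cast h.le
      nlinarith [sq_nonneg ((p.2 : ℕ) : ℝ), (Nat.cast_nonneg M : (0 : ℝ) ≤ M)]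
    · have : (M : ℝ) ≤ (p.2 : ℕ) := by exact_mod_cast h.le
      nlinarith [sq_nonneg ((p.1 : ℕ) : ℝ), (Nat.cast_nonneg M : (0 : ℝ) ≤ M)]

/-- The factor `2` comes from `(a + b)² ≤ 2 (a² + b²)` for the two pure second derivatives. -/
theorem norm_laplacian_sq_le (u : L2) : ‖dX (dX u) + dY (dY u)‖ ^ 2 ≤ 2 * normH2 u ^ 2 := by
  rw [normH2, Real.sq_sqrt (by positivity)]
  have h := pow_le_pow_left₀ (norm_nonneg _) (norm_add_le (dX (dX u)) (dY (dY u))) 2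
  nlinarith [sq_nonneg (‖dX (dX u)‖ - ‖dY (dY u)‖), sq_nonneg ‖u‖, sq_nonneg ‖dX u‖,
    sq_nonneg ‖dY u‖, sq_nonneg ‖dX (dY u)‖]

/-- The energy norm of the remainder: `(π M)² ‖u - Π_M u‖²_{H₀¹} ≤ 2 ‖u‖²_{H²}`. -/
theorem normH01_remainder_sq_le {u : L2} (h2 : MemH2 u) (h0 : MemH01 u) (M : ℕ) :
    Real.pi ^ 2 * M ^ 2 * normH01 (u - spectralProj M u) ^ 2 ≤ 2 * normH2 u ^ 2 := by
  obtain ⟨P, hP⟩ := exists_hasLaplacian_spectralProj M u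
  have hV : HasLaplacian (u - spectralProj M u) (dX (dX u) + dY (dY u) + (-1 : ℝ) • P) := by
    simpa [sub_eq_add_neg] using h2.hasLaplacian.add (hP.const_smul (-1))
  set V := dX (dX u) + dY (dY u) + (-1 : ℝ) • P
  have hv := h0.sub (memH01_spectralProj M u)
  have e := hV.inner_self hv
  have i := abs_real_inner_le_norm (u - spectralProj M u) V
  have hVF := h2.hasLaplacian.norm_remainder_le h0 hV
  -- Green's identity with Cauchy–Schwarz bounds the energy by `‖v‖ ‖V‖`. The gap `π² M²` is then
  -- spent on `‖v‖`, leaving `‖V‖²`.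
  calc Real.pi ^ 2 * M ^ 2 * normH01 (u - spectralProj M u) ^ 2
      ≤ Real.pi ^ 2 * M ^ 2 * (‖u - spectralProj M u‖ * ‖V‖) := by
        gcongr
        exact (by rw [e, abs_neg, abs_of_nonneg (sq_nonneg _)] at i; exact i)
    _ = (Real.pi ^ 2 * M ^ 2 * ‖u - spectralProj M u‖) * ‖V‖ := by ring
    _ ≤ ‖V‖ * ‖V‖ := by gcongr; exact HasLaplacian.mul_norm_remainder_le h0 hV
    _ ≤ ‖dX (dX u) + dY (dY u)‖ ^ 2 := by rw [← sq]; gcongr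
    _ ≤ 2 * normH2 u ^ 2 := norm_laplacian_sq_le u

end SquareSobolev

/-! ### The main theorem -/

theorem mainTheorem1 :
    ∃ C : ℝ, 0 < C ∧
      ∀ u : SquareSobolev.L2, SquareSobolev.MemH2 u → SquareSobolev.MemH01 u →
        HasSum (fun p : ℕ+ × ℕ+ =>
          SquareSobolev.sineCoeff u p.1 p.2 • SquareSobolev.sineMode p.1 p.2) u ∧
        ∀ M : ℕ, 2 ≤ M →
          SquareSobolev.MemH01 (u - SquareSobolev.spectralProj M u) ∧
          SquareSobolev.normH01 (u - SquareSobolev.spectralProj M u)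
            ≤ C * (√(Real.log M) / M) * SquareSobolev.normH2 u := by
  -- The constant `1` suffices: for `M ≥ 2` one has `π² log M ≥ 4 · (1/2) = 2`, which absorbs the
  -- factor `2` of the energy bound.
  refine ⟨1, one_pos, fun u h2 h0 => ⟨SquareSobolev.hasSum_sineCoeff_smul u, fun M hM =>
    ⟨h0.sub (SquareSobolev.memH01_spectralProj M u), ?_⟩⟩⟩
  have hM2 : (2 : ℝ) ≤ M := by exact_mod_cast hM
  have hM0 : (0 : ℝ) < M := by linarith
  have hlog : 1 / 2 ≤ Real.log M :=
    (by linarith [Real.log_two_gt_d9] : (1 / 2 : ℝ) ≤ Real.log 2).trans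
      (Real.log_le_log two_pos hM2)
  have hN : 0 ≤ SquareSobolev.normH2 u := Real.sqrt_nonneg _
  have key := SquareSobolev.normH01_remainder_sq_le h2 h0 M
  refine le_of_sq_le_sq ?_ (by positivity)
  rw [one_mul, mul_pow, div_pow, Real.sq_sqrt (by linarith), div_mul_eq_mul_div,
    le_div_iff₀ (by positivity)]
  have hπ : 4 ≤ Real.pi ^ 2 := by nlinarith [Real.pi_gt_three]
  have hn : 0 ≤ (M : ℝ) ^ 2 * SquareSobolev.normH01 (u - SquareSobolev.spectralProj M u) ^ 2 := by
    positivity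
  nlinarith [mul_le_mul_of_nonneg_right hπ hn, mul_le_mul_of_nonneg_right hlog (sq_nonneg
    (SquareSobolev.normH2 u))]
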